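/- **Definitions.** Identify $\mathbb{C}$ with $\mathbb{R}^2$ by $x+iy\mapsto(x,y)$, and let $\mathbb{R}^n_+=\{x\in\mathbb{R}^n: x_1>0\}$. A connected open set $\Omega\subset\mathbb{R}^n$ is a *smooth domain* if for each $x\in\partial\Omega$ there are an open ball $B_x$ centred at $x$ and a smooth bijection $\Phi_x:B_x\to D\subset\mathbb{R}^n$ with smooth inverse ($D$ open) such that $\Phi_x(B_x\cap\Omega)\subset\mathbb{R}^n_+$ and $\Phi_x(B_x\cap\partial\Omega)\subset\partial\mathbb{R}^n_+$. A smooth domain $\Omega$ is a *Smooth Uniform Lipschitz Domain (SULD)* if the balls $B_x$ and maps $\Phi_x$ can be chosen, one pair for each $x\in\partial\Omega$, so that there are an open set $U^0\subseteq\Omega$ and a countable (possibly finite or empty) family $\{U^k\}_{k\ge1}\subset\{B_x:x\in\partial\Omega\}$, with associated maps $\Phi_k=(\Phi_k^1,\dots,\Phi_k^n)$, for which 1. $\overline\Omega\subseteq U^0\cup\bigcup_{k\ge1}U^k$; 2. at each point of $U^k\cap\partial\Omega$, the inward unit normal $\gamma$ satisfies $\nabla\Phi_k^i\cdot\gamma=\delta_{1i}|\nabla\Phi_k^i|$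 for all $i$ and $k\ge 1$; 3. there are constants $\mathscr C,\mathscr C_3>0$ and $\mathscr C_1,\mathscr C_2\ge 0$, independent of $k$, such that for all $k\ge1$ and all $i,j$: - $|x-y|/\mathscr C\le|\Phi_k(x)-\Phi_k(y)|\le\mathscr C|x-y|$ for all $x,y\in U^k$; - on $U^k$ the functions $\partial\Phi_k^i/\partial x_j$ and $\Delta\Phi_k^i$ are bounded in absolute value by $\mathscr C_1$ and are Lipschitz with constant $\mathscr C_2$; - $\mathscr C_3^{-1}|v|^2\le v^TJ_kJ_k^Tv\le\mathscr C_3|v|^2$ at each point of $U^k$ and for each $v\in\mathbb{R}^n$, where $J_k=(\partial\Phi_k^i/\partial x_j)_{i,j}$ is the Jacobian matrix of $\Phi_k$. A connected open set $\emptyset\ne\Omega\subsetneq\mathbb{C}$ is an *analytic domain* if there is a function $f$, analytic and injective on an open neighbourhood of the unit circle $\partial\mathbb{D}$, such that $\partial\Omega=f(\partial\mathbb{D})$. **Proposition.** The unit disk $\mathbb{D}=\{z\in\mathbb{C}:|z|<1\}$ is a SULD. More generally, every analytic domain in $\mathbb{C}$, and in particular every analytic simply connected domain, is a SULD. -/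

import Mathlib

open scoped ContDiff NNReal

noncomputable section

namespace SULD

variable {n : ℕ} [NeZero n]

/-- The coordinate indexed by `0 : Fin n` is the one written `x₁` in mathematics; the half-space
`ℝⁿ₊` is `{x | 0 < x 0}` and its boundary is `{x | x 0 = 0}`. `BoundaryChart Ω x` is an open ball
centred at `x`, together with a smooth bijection with smooth inverse from it onto a subset of `ℝⁿ`
that sends `Ω` into `ℝⁿ₊` and `∂Ω` into `∂ℝⁿ₊`. -/
structure BoundaryChart (Ω : Set (EuclideanSpace ℝ (Fin n))) (x : EuclideanSpace ℝ (Fin n)) where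
  radius : ℝ
  radius_pos : 0 < radius
  map : OpenPartialHomeomorph (EuclideanSpace ℝ (Fin n)) (EuclideanSpace ℝ (Fin n))
  source_eq : map.source = Metric.ball x radius
  smooth : ContDiffOn ℝ ∞ map map.source
  smooth_symm : ContDiffOn ℝ ∞ map.symm map.target
  interior_mem : ∀ y ∈ map.source ∩ Ω, 0 < map y 0
  boundary_mem : ∀ y ∈ map.source ∩ frontier Ω, map y 0 = 0

/-- A connected open set with a boundary chart at each boundary point. -/
structure IsSmoothDomain (Ω : Set (EuclideanSpace ℝ (Fin n))) : Prop where
  isOpen : IsOpen Ω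
  isConnected : IsConnected Ω
  exists_chart : ∀ x ∈ frontier Ω, Nonempty (BoundaryChart Ω x)

/-- `v` is tangent to the set `M` at `x`: it is the velocity at `x` of a curve in `M`. -/
def IsTangent (M : Set (EuclideanSpace ℝ (Fin n))) (x v : EuclideanSpace ℝ (Fin n)) : Prop :=
  ∃ c : ℝ → EuclideanSpace ℝ (Fin n),
    c 0 = x ∧ HasDerivAt c v 0 ∧ ∀ᶠ t in nhds (0 : ℝ), c t ∈ M

/-- `γ` is the inward pointing unit normal of `Ω` at the boundary point `x`. -/
structure IsInwardUnitNormal (Ω : Set (EuclideanSpace ℝ (Fin n)))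
    (x γ : EuclideanSpace ℝ (Fin n)) : Prop where
  norm_eq_one : ‖γ‖ = 1
  orthogonal : ∀ v, IsTangent (frontier Ω) x v → inner ℝ γ v = 0
  inward : ∀ᶠ t in nhdsWithin (0 : ℝ) (Set.Ioi 0), x + t • γ ∈ Ω

/-- The `i`-th component `Φⁱ` of a map `Φ`. -/
def component (Φ : EuclideanSpace ℝ (Fin n) → EuclideanSpace ℝ (Fin n)) (i : Fin n) :
    EuclideanSpace ℝ (Fin n) → ℝ :=
  fun x => Φ x i

/-- The partial derivative `∂Φⁱ/∂xⱼ`. -/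
def partialDeriv (Φ : EuclideanSpace ℝ (Fin n) → EuclideanSpace ℝ (Fin n)) (i j : Fin n) :
    EuclideanSpace ℝ (Fin n) → ℝ :=
  fun x => fderiv ℝ (component Φ i) x (EuclideanSpace.single j 1)

/-- The Jacobian matrix `J = (∂Φⁱ/∂xⱼ)` at `x`. -/
def jacobian (Φ : EuclideanSpace ℝ (Fin n) → EuclideanSpace ℝ (Fin n))
    (x : EuclideanSpace ℝ (Fin n)) : Matrix (Fin n) (Fin n) ℝ :=
  Matrix.of fun i j => partialDeriv Φ i j x

/-- On `U ∩ ∂Ω`, `Φ` sends the inward unit normal `γ` to a vector pointing in the direction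
`(1, 0, …, 0)`, in the form `∇Φⁱ · γ = δ₁ᵢ |∇Φⁱ|`. -/
def MapsNormalToFirstAxis (Ω U : Set (EuclideanSpace ℝ (Fin n)))
    (Φ : EuclideanSpace ℝ (Fin n) → EuclideanSpace ℝ (Fin n)) : Prop :=
  ∀ x ∈ U ∩ frontier Ω, ∃ γ, IsInwardUnitNormal Ω x γ ∧
    ∀ i : Fin n, inner ℝ (gradient (component Φ i) x) γ =
      if i = 0 then ‖gradient (component Φ i) x‖ else 0

/-- The quantitative bounds on a coordinate map `Φ` on the open set `U`: bi-Lipschitz with constant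
`C`; first partial derivatives and Laplacians of components bounded by `C₁` and Lipschitz with
constant `C₂`; and `C₃⁻¹ |v|² ≤ vᵀ J Jᵀ v ≤ C₃ |v|²`. -/
structure HasChartBounds (U : Set (EuclideanSpace ℝ (Fin n)))
    (Φ : EuclideanSpace ℝ (Fin n) → EuclideanSpace ℝ (Fin n)) (C C₁ : ℝ) (C₂ : ℝ≥0) (C₃ : ℝ) :
    Prop where
  bilipschitz : ∀ x ∈ U, ∀ y ∈ U,
    ‖x - y‖ / C ≤ ‖Φ x - Φ y‖ ∧ ‖Φ x - Φ y‖ ≤ C * ‖x - y‖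
  partialDeriv_le : ∀ i j, ∀ x ∈ U, |partialDeriv Φ i j x| ≤ C₁
  laplacian_le : ∀ i, ∀ x ∈ U, |Laplacian.laplacian (component Φ i) x| ≤ C₁
  partialDeriv_lipschitz : ∀ i j, LipschitzOnWith C₂ (partialDeriv Φ i j) U
  laplacian_lipschitz : ∀ i, LipschitzOnWith C₂ (Laplacian.laplacian (component Φ i)) U
  jacobian_bounds : ∀ x ∈ U, ∀ v : Fin n → ℝ,
    C₃⁻¹ * (v ⬝ᵥ v) ≤ v ⬝ᵥ (jacobian Φ x * (jacobian Φ x).transpose).mulVec v ∧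
      v ⬝ᵥ (jacobian Φ x * (jacobian Φ x).transpose).mulVec v ≤ C₃ * (v ⬝ᵥ v)

/-- Smooth Uniform Lipschitz Domain: a smooth domain with a choice of boundary charts, one for each
boundary point, such that the balls of countably many of them (those centred at the points of `S`),
together with an open set `U₀ ⊆ Ω`, cover the closure of `Ω`, and the charts of this countable
family respect the normals and satisfy the quantitative bounds with common constants. -/
def IsSULD (Ω : Set (EuclideanSpace ℝ (Fin n))) : Prop :=
  IsSmoothDomain Ω ∧
  ∃ (chart : ∀ x : frontier Ω, BoundaryChart Ω (x : EuclideanSpace ℝ (Fin n)))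
    (U₀ : Set (EuclideanSpace ℝ (Fin n))) (S : Set (frontier Ω)),
    IsOpen U₀ ∧ U₀ ⊆ Ω ∧ S.Countable ∧
    closure Ω ⊆ U₀ ∪ ⋃ x ∈ S, (chart x).map.source ∧
    (∀ x ∈ S, MapsNormalToFirstAxis Ω (chart x).map.source (chart x).map) ∧
    ∃ (C C₁ : ℝ) (C₂ : ℝ≥0) (C₃ : ℝ), 0 < C ∧ 0 < C₃ ∧
      ∀ x ∈ S, HasChartBounds (chart x).map.source (chart x).map C C₁ C₂ C₃

/-- A domain `Ω ⊊ ℂ` whose boundary is the image of the unit circle under a function that is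
analytic and injective (univalent) on an open neighbourhood of the unit circle. -/
structure IsAnalyticDomain (Ω : Set ℂ) : Prop where
  isOpen : IsOpen Ω
  isConnected : IsConnected Ω
  ne_univ : Ω ≠ Set.univ
  frontier_eq : ∃ (V : Set ℂ) (f : ℂ → ℂ), IsOpen V ∧ Metric.sphere (0 : ℂ) 1 ⊆ V ∧
    AnalyticOnNhd ℂ f V ∧ Set.InjOn f V ∧ frontier Ω = f '' Metric.sphere (0 : ℂ) 1

/-- The usual identification `x + iy ↦ (x, y)` of `ℂ` with the Euclidean plane `ℝ²`. -/
def toPlane : ℂ ≃ₗᵢ[ℝ] EuclideanSpace ℝ (Fin 2) :=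
  Complex.orthonormalBasisOneI.repr

end SULD

end

/-! Let `f` be univalent near the unit circle with image curve `∂Ω`. The map `f ∘ exp` is locally
univalent on a thin strip around the imaginary axis and meets `∂Ω` exactly on the axis. Each open
half of the strip has a connected image missing `∂Ω`, so it lies in `Ω` or is disjoint from it. Some
half lies in `Ω`, because boundary points are limits of `Ω` and `f ∘ exp` is open. Not both do: by
the argument principle the winding number of `f(∂𝔻)` jumps by one across the curve, while it is
constant on the connected set `Ω` (`not_mem_both_sides`). After a reflection if needed, this gives
`F` with `F u ∈ Ω` iff `0 < Re u` (`IsAnalyticDomain.exists_strip_param`).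

Local inverses of `F` are the charts. They are conformal, so by Cauchy–Riemann the two component
gradients are orthogonal and of equal length. This gives both the normal condition, with `γ` the
normalized gradient of the first component, and `J Jᵀ = |F'|⁻² I` (`hasGoodChart_of_conformal`).
Smoothness supplies all other bounds on small balls, and compactness of `∂Ω` makes the constants
uniform (`isSULD_of_isCompact_frontier`). The disk is the case `f = id`. -/

open Set Metric Filter Topology

namespace SULD

/-! ### Univalent functions have nonvanishing derivative -/

section

open Complex

/-- An injective analytic function has nonvanishing derivative. -/
theorem deriv_ne_zero_of_injOn {f : ℂ → ℂ} {V : Set ℂ} {a : ℂ} (hf : AnalyticAt ℂ f a)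
    (hV : V ∈ 𝓝 a) (hinj : InjOn f V) : deriv f a ≠ 0 := by
  intro h0
  have haV := mem_of_mem_nhds hV
  have hF : AnalyticAt ℂ (fun z => f z - f a) a := hf.sub analyticAt_const
  obtain ⟨n, g, hg, hga, hfg⟩ := hF.exists_eventuallyEq_pow_smul_nonzero_iff.mpr (by
    intro h
    have : ∀ᶠ z in 𝓝[≠] a, False := by
      filter_upwards [nhdsWithin_le_nhds h, nhdsWithin_le_nhds hV, self_mem_nhdsWithin]
        with z h1 h2 h3
      exact h3 (hinj h2 haV (sub_eq_zero.1 h1))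
    obtain ⟨_, h⟩ := this.exists
    exact h)
  have hn0 : n ≠ 0 := by
    rintro rfl
    have := hfg.self_of_nhds
    simp only [sub_self, pow_zero, one_smul] at this
    exact hga this.symm
  have hn1 : n ≠ 1 := by
    rintro rfl
    have h1 := EventuallyEq.deriv_eq hfg
    have h2 : HasDerivAt (fun z => (z - a) ^ 1 • g z) (g a) a := by
      have h3 : HasDerivAt (fun z => (z - a) * g z) (1 * g a + (a - a) * deriv g a) a :=
        ((hasDerivAt_id a).sub_const a).mul hg.differentiableAt.hasDerivAt
      simpa only [pow_one, smul_eq_mul, sub_self, zero_mul, add_zero, one_mul] using h3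
    rw [h2.deriv, deriv_sub_const, h0] at h1
    exact hga h1.symm
  obtain ⟨c, hc⟩ := IsAlgClosed.exists_pow_nat_eq (g a) (Nat.pos_of_ne_zero hn0)
  have hnC : (n : ℂ) ≠ 0 := by exact_mod_cast hn0
  -- An analytic `n`-th root of `g` near `a`; dividing by `g a` keeps the argument of the logarithm
  -- near `1`, away from the branch cut.
  set h : ℂ → ℂ := fun z => c * exp (log (g z / g a) / n) with hh
  have hha : h a = c := by simp [hh, div_self hga]
  have hc0 : c ≠ 0 := by
    rintro rfl
    exact hga (by rw [← hc, zero_pow hn0])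
  have hhan : AnalyticAt ℂ h a := by
    have h1 : AnalyticAt ℂ (fun z => log (g z / g a)) a :=
      (hg.div analyticAt_const hga).clog (by simp [div_self hga])
    exact analyticAt_const.mul (h1.div analyticAt_const hnC).cexp
  have hhn : ∀ᶠ z in 𝓝 a, h z ^ n = g z := by
    filter_upwards [hg.continuousAt.eventually_ne hga] with z hz
    simp only [hh, mul_pow, ← Complex.exp_nat_mul, hc]
    rw [mul_div_cancel₀ _ hnC, exp_log (div_ne_zero hz hga), mul_div_cancel₀ _ hga]
  have hk : HasStrictDerivAt (fun z => (z - a) * h z) c a := by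
    have h1 : HasStrictDerivAt (fun z => z - a) 1 a := (hasStrictDerivAt_id a).sub_const a
    simpa only [hha, sub_self, zero_mul, add_zero, one_mul] using
      h1.fun_mul hhan.hasStrictDerivAt
  have hmap := hk.map_nhds_eq hc0
  have hW : {z | z ∈ V ∧ f z - f a = ((z - a) * h z) ^ n} ∈ 𝓝 a := by
    filter_upwards [hV, hfg, hhn] with z h1 h2 h3
    exact ⟨h1, by rw [h2, mul_pow, h3, smul_eq_mul]⟩
  have hI := hmap ▸ image_mem_map (m := fun z => (z - a) * h z) hW
  simp only [sub_self, zero_mul] at hI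
  have hη := Complex.isPrimitiveRoot_exp n hn0
  set η := exp (2 * Real.pi * I / n)
  have hη1 : η ≠ 1 := hη.ne_one (by omega)
  have hI2 : ∀ᶠ t in 𝓝 (0 : ℂ), η * t ∈
      (fun z => (z - a) * h z) '' {z | z ∈ V ∧ f z - f a = ((z - a) * h z) ^ n} := by
    have : Tendsto (fun t => η * t) (𝓝 (0 : ℂ)) (𝓝 0) := by
      have := (continuous_const_mul η).tendsto (0 : ℂ)
      rwa [mul_zero] at this
    exact this hI
  -- Near `a`, `f - f a` is the `n`-th power of the local coordinate `(z - a) * h z`. For small `t ≠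
  -- 0` both `t` and `η * t` are values of this coordinate with equal `n`-th powers, so injectivity
  -- identifies their preimages and forces `η = 1`.
  have : ∀ᶠ t in 𝓝[≠] (0 : ℂ), False := by
    filter_upwards [nhdsWithin_le_nhds hI, nhdsWithin_le_nhds hI2, self_mem_nhdsWithin]
      with t h1 h2 h3
    obtain ⟨x, ⟨hx, hx'⟩, hxt⟩ := h1
    obtain ⟨y, ⟨hy, hy'⟩, hyt⟩ := h2
    simp only at hxt hyt
    rw [hxt] at hx'
    rw [hyt, mul_pow, hη.pow_eq_one, one_mul] at hy'
    have hxy : x = y := hinj hx hy (sub_left_injective (hx'.trans hy'.symm))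
    rw [hxy, hyt] at hxt
    exact hη1 (mul_right_cancel₀ h3 (hxt.trans (one_mul t).symm))
  obtain ⟨_, h⟩ := this.exists
  exact h

/-! ### Winding numbers of image circles -/

/-- `2πi` times the winding number around `z` of the image under `f` of the circle of radius `ρ`. -/
noncomputable def windingIntegral (f : ℂ → ℂ) (ρ : ℝ) (z : ℂ) : ℂ :=
  ∮ w in C(0, ρ), deriv f w / (f w - z)

section winding

variable {f : ℂ → ℂ} {V : Set ℂ}

/-- The integral is locally constant off the curve, and local constancy propagates along a
preconnected set. -/
theorem windingIntegral_eq_of_isPreconnected (hV : IsOpen V) (hf : DifferentiableOn ℂ f V) {ρ : ℝ}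
    (hρ : 0 ≤ ρ) (hρV : sphere 0 ρ ⊆ V) {s : Set ℂ} (hs : IsPreconnected s)
    (hd : Disjoint s (f '' sphere 0 ρ)) {x y : ℂ} (hx : x ∈ s) (hy : y ∈ s) :
    windingIntegral f ρ x = windingIntegral f ρ y := by
  refine hs.induction₂ (fun x y => windingIntegral f ρ x = windingIntegral f ρ y) ?_
    (fun _ _ _ _ _ _ h1 h2 => h1.trans h2) (fun _ _ _ _ h => h.symm) hx hy
  intro x hx
  have hK : IsCompact (f '' sphere 0 ρ) :=
    (isCompact_sphere 0 ρ).image_of_continuousOn (hf.continuousOn.mono hρV)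
  obtain ⟨δ, hδ, hball⟩ := Metric.isOpen_iff.1 hK.isClosed.isOpen_compl x
    (disjoint_left.1 hd hx)
  refine nhdsWithin_le_nhds ?_
  filter_upwards [ball_mem_nhds x hδ] with y hy
  have hdc : ContinuousOn (deriv f) (sphere 0 ρ) := (hf.deriv hV).continuousOn.mono hρV
  have hfc : ContinuousOn f (sphere 0 ρ) := hf.continuousOn.mono hρV
  have key : ∀ p ∈ ball x δ, ∀ w ∈ sphere (0 : ℂ) ρ, f w - p ≠ 0 := fun p hp w hw h =>
    hball hp ⟨w, hw, sub_eq_zero.1 h⟩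
  have hint : ∀ p ∈ ball x δ, CircleIntegrable (fun w => deriv f w / (f w - p)) 0 ρ :=
    fun p hp => ContinuousOn.circleIntegrable hρ
      (hdc.div (hfc.sub continuousOn_const) (key p hp))
  have hxb := mem_ball_self (x := x) hδ
  rw [eq_comm, ← sub_eq_zero, windingIntegral, windingIntegral,
    ← circleIntegral.integral_sub (hint y hy) (hint x hxb)]
  -- The difference of the integrands has this logarithm as a primitive: `y` is closer to `x` than
  -- the curve is, so the quotient stays within distance `1` of `1`.
  refine circleIntegral.integral_eq_zero_of_hasDerivWithinAt
    (f := fun w => log ((f w - y) / (f w - x))) hρ fun w hw => ?_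
  have hdw := (hf.differentiableAt (hV.mem_nhds (hρV hw))).hasDerivAt
  have h1 := key x hxb w hw
  have h2 := key y hy w hw
  have h3 : (f w - y) / (f w - x) ∈ slitPlane := by
    have : (f w - y) / (f w - x) = 1 + (x - y) / (f w - x) := by field_simp; ring
    rw [this]
    refine mem_slitPlane_of_norm_lt_one ?_
    rw [norm_div, div_lt_one (norm_pos_iff.2 h1)]
    have h4 : f w ∉ ball x δ := fun h => hball h ⟨w, hw, rfl⟩
    rw [mem_ball, not_lt, dist_eq_norm] at h4
    rw [mem_ball, dist_comm, dist_eq_norm] at hy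
    exact hy.trans_le h4
  have h5 := ((hdw.sub_const y).fun_div (hdw.sub_const x) h1).clog h3
  convert h5.hasDerivWithinAt using 1
  field_simp

/-- By injectivity `f w = f a` has no solution in the closed annulus, so the integrand is
holomorphic there and Cauchy's theorem applies. -/
theorem windingIntegral_eq_of_notMem (hV : IsOpen V) (hf : DifferentiableOn ℂ f V)
    (hinj : InjOn f V) {r R : ℝ} (hr : 0 < r) (hrR : r ≤ R)
    (hA : closedBall 0 R \ ball 0 r ⊆ V) {a : ℂ} (ha : a ∈ V)
    (ha' : a ∉ closedBall (0 : ℂ) R \ ball 0 r) :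
    windingIntegral f R (f a) = windingIntegral f r (f a) := by
  have key : ∀ w ∈ closedBall (0 : ℂ) R \ ball 0 r, f w - f a ≠ 0 := fun w hw h =>
    ha' ((hinj (hA hw) ha (sub_eq_zero.1 h)) ▸ hw)
  have hd : ∀ w ∈ closedBall (0 : ℂ) R \ ball 0 r,
      DifferentiableAt ℂ (fun w => deriv f w / (f w - f a)) w := fun w hw =>
    ((hf.deriv hV).differentiableAt (hV.mem_nhds (hA hw))).div
      ((hf.differentiableAt (hV.mem_nhds (hA hw))).sub_const _) (key w hw)
  exact circleIntegral_eq_of_differentiable_on_annulus_off_countable hr hrR countable_empty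
    (fun w hw => (hd w hw).continuousAt.continuousWithinAt)
    (fun w hw => hd w ⟨ball_subset_closedBall hw.1.1, fun h => hw.1.2 (ball_subset_closedBall h)⟩)

/-- Writing `f w - f a = (w - a) * g w` with `g` zero-free splits the integrand into `(w - a)⁻¹`,
which contributes `2πi` on the outer circle only, and `g' / g`, which is holomorphic and contributes
equally on both circles. -/
theorem windingIntegral_eq_add_of_mem (hV : IsOpen V) (hf : DifferentiableOn ℂ f V)
    (hinj : InjOn f V) {r R : ℝ} (hr : 0 < r) (hrR : r ≤ R)
    (hA : closedBall 0 R \ ball 0 r ⊆ V) {a : ℂ} (ha : a ∈ ball (0 : ℂ) R \ closedBall 0 r) :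
    windingIntegral f R (f a) = windingIntegral f r (f a) + 2 * Real.pi * I := by
  have haV : a ∈ V := hA ⟨ball_subset_closedBall ha.1, fun h => ha.2 (ball_subset_closedBall h)⟩
  set g := dslope f a with hg
  have hgd : DifferentiableOn ℂ g V := (differentiableOn_dslope (hV.mem_nhds haV)).2 hf
  have hg0 : ∀ w ∈ V, g w ≠ 0 := by
    intro w hw
    rcases eq_or_ne w a with rfl | hwa
    · rw [hg, dslope_same]
      exact deriv_ne_zero_of_injOn (hf.analyticAt (hV.mem_nhds hw)) (hV.mem_nhds hw) hinj
    · rw [hg, dslope_of_ne _ hwa, slope_def_field]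
      exact div_ne_zero (fun h => hwa (hinj hw haV (sub_eq_zero.1 h))) (sub_ne_zero.2 hwa)
  have hfg : ∀ w, f w - f a = (w - a) * g w := fun w => by
    rw [hg, ← smul_eq_mul, sub_smul_dslope]
  have hquot : ∀ w ∈ V, w ≠ a → deriv f w / (f w - f a) = (w - a)⁻¹ + deriv g w / g w := by
    intro w hw hwa
    have h1 : HasDerivAt (fun w => f w - f a) (1 * g w + (w - a) * deriv g w) w := by
      rw [funext hfg]
      exact ((hasDerivAt_id w).sub_const a).mul
        (hgd.differentiableAt (hV.mem_nhds hw)).hasDerivAt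
    have h2 : deriv f w = 1 * g w + (w - a) * deriv g w := by
      rw [← h1.deriv, deriv_sub_const]
    have h3 := hg0 w hw
    have h4 := sub_ne_zero.2 hwa
    rw [h2, hfg]
    field_simp
  have hdg : ∀ w ∈ V, DifferentiableAt ℂ (fun w => deriv g w / g w) w := fun w hw =>
    ((hgd.deriv hV).differentiableAt (hV.mem_nhds hw)).div
      (hgd.differentiableAt (hV.mem_nhds hw)) (hg0 w hw)
  have hsplit : ∀ ρ, 0 < ρ → sphere 0 ρ ⊆ V → a ∉ sphere 0 ρ → windingIntegral f ρ (f a) =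
      (∮ w in C(0, ρ), (w - a)⁻¹) + ∮ w in C(0, ρ), deriv g w / g w := by
    intro ρ hρ hρV haρ
    rw [windingIntegral, ← circleIntegral.integral_add]
    · exact circleIntegral.integral_congr hρ.le fun w hw =>
        hquot w (hρV hw) fun h => haρ (h ▸ hw)
    · exact ContinuousOn.circleIntegrable hρ.le ((continuousOn_id.sub continuousOn_const).inv₀
        fun w hw => sub_ne_zero.2 fun h : w = a => haρ (h ▸ hw))
    · exact ContinuousOn.circleIntegrable hρ.le
        fun w hw => (hdg w (hρV hw)).continuousAt.continuousWithinAt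
  have haR : ‖a‖ < R := by simpa using ha.1
  have har : r < ‖a‖ := by simpa using ha.2
  have hsR : sphere 0 R ⊆ V := fun w hw => hA ⟨sphere_subset_closedBall hw, by
    rw [mem_sphere_zero_iff_norm] at hw
    simpa [hw] using hrR⟩
  have hsr : sphere 0 r ⊆ V := fun w hw => hA (by
    rw [mem_sphere_zero_iff_norm] at hw
    simp [hw, hrR])
  rw [hsplit R (hr.trans_le hrR) hsR (by simp [haR.ne]), hsplit r hr hsr (by simp [har.ne']),
    circleIntegral.integral_sub_inv_of_mem_ball ha.1,
    circleIntegral_eq_zero_of_differentiable_on_off_countable (f := fun w => (w - a)⁻¹) hr.le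
      countable_empty, circleIntegral_eq_of_differentiable_on_annulus_off_countable hr hrR
      countable_empty (fun w hw => (hdg w (hA hw)).continuousAt.continuousWithinAt)
      (fun w hw => hdg w (hA ⟨ball_subset_closedBall hw.1.1,
        fun h => hw.1.2 (ball_subset_closedBall h)⟩))]
  · ring
  · exact (continuousOn_id.sub continuousOn_const).inv₀
      fun w hw => sub_ne_zero.2 fun h : w = a => ha.2 (h ▸ hw)
  · exact fun w hw => ((differentiableAt_id).sub_const a).inv
      (sub_ne_zero.2 fun h => ha.2 (ball_subset_closedBall (h ▸ hw.1)))

/-- The open annulus `e^α < |w| < e^β` is the image of a vertical strip. -/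
theorem isPreconnected_image_strip {F : ℂ → ℂ} {α β : ℝ}
    (hF : ContinuousOn F {u | α < u.re ∧ u.re < β}) :
    IsPreconnected (F '' {u | α < u.re ∧ u.re < β}) := by
  refine IsPreconnected.image ?_ F hF
  exact ((convex_halfSpace_re_gt α).inter (convex_halfSpace_re_lt β)).isPreconnected

end winding

/-! ### One-sided parametrization of the boundary -/

/-- The distance from `exp u` to the circle point `exp (i Im u)` is `|exp (Re u) - 1|`, and the
compact circle has a uniform thickening inside `V`. -/
theorem exists_strip_mapsTo_exp {V : Set ℂ} (hV : IsOpen V) (hS : sphere (0 : ℂ) 1 ⊆ V) :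
    ∃ δ : ℝ, 0 < δ ∧ ∀ u : ℂ, |u.re| < δ → exp u ∈ V := by
  obtain ⟨ε, hε, hεV⟩ := (isCompact_sphere (0 : ℂ) 1).exists_thickening_subset_open hV hS
  obtain ⟨δ, hδ, h⟩ := Metric.continuousAt_iff.1 (Real.continuous_exp.continuousAt (x := 0)) ε hε
  refine ⟨δ, hδ, fun u hu => hεV (mem_thickening_iff.2 ⟨exp (u.im * I), ?_, ?_⟩)⟩
  · rw [mem_sphere_zero_iff_norm, norm_exp_ofReal_mul_I]
  · have h1 := h (x := u.re) (by rwa [Real.dist_eq, sub_zero])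
    rw [Real.dist_eq, Real.exp_zero] at h1
    have h2 : exp u - exp (u.im * I) = ((Real.exp u.re - 1 : ℝ) : ℂ) * exp (u.im * I) := by
      conv_lhs => rw [← re_add_im u, exp_add]
      push_cast
      simp
      ring
    rw [dist_eq_norm, h2, norm_mul, norm_exp_ofReal_mul_I, mul_one, norm_real]
    exact h1

theorem subset_or_disjoint_of_disjoint_frontier {Ω s : Set ℂ} (hΩ : IsOpen Ω)
    (hs : IsPreconnected s) (h : Disjoint s (frontier Ω)) : s ⊆ Ω ∨ Disjoint s Ω := by
  rcases hs.subset_or_subset hΩ isClosed_closure.isOpen_compl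
    (disjoint_compl_right.mono_left subset_closure) (fun x hx => by
      by_cases hxΩ : x ∈ Ω
      · exact Or.inl hxΩ
      · exact Or.inr fun hc => disjoint_left.1 h hx (by rw [hΩ.frontier_eq]; exact ⟨hc, hxΩ⟩))
    with h1 | h1
  · exact Or.inl h1
  · exact Or.inr (disjoint_left.2 fun x hx hxΩ => h1 hx (subset_closure hxΩ))

/-- A domain that avoids the image of the unit circle under a map that is univalent near the circle
cannot contain points on both sides of it. -/
theorem not_mem_both_sides {f : ℂ → ℂ} {V Ω : Set ℂ} (hV : IsOpen V) (hf : DifferentiableOn ℂ f V)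
    (hinj : InjOn f V) {δ : ℝ} (hδ : 0 < δ) (hδV : ∀ u : ℂ, |u.re| < δ → exp u ∈ V)
    (hΩ : IsPreconnected Ω) (hd : Disjoint Ω (f '' sphere 0 1))
    (h1 : f (exp ((δ / 2 : ℝ) : ℂ)) ∈ Ω) (h2 : f (exp ((-(δ / 2) : ℝ) : ℂ)) ∈ Ω) : False := by
  have hann : ∀ w : ℂ, Real.exp (-δ) < ‖w‖ → ‖w‖ < Real.exp δ → w ∈ V := by
    intro w hw1 hw2
    have hw0 : 0 < ‖w‖ := (Real.exp_pos _).trans hw1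
    rw [← exp_log (norm_pos_iff.1 hw0)]
    refine hδV _ ?_
    rw [log_re, abs_lt]
    exact ⟨(Real.lt_log_iff_exp_lt hw0).2 hw1, (Real.log_lt_iff_lt_exp hw0).2 hw2⟩
  -- Chosen so that `r < exp (-δ/2) < 1 < exp (δ/2)`: only the inner point lies between the circles
  -- of radius `r` and `1`.
  set r := Real.exp (-(2 * δ / 3)) with hr
  have hr0 : 0 < r := Real.exp_pos _
  have hr1 : r ≤ 1 := Real.exp_le_one_iff.2 (by linarith)
  have hrδ : Real.exp (-δ) < r := Real.exp_lt_exp.2 (by linarith)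
  have h1δ : 1 < Real.exp δ := Real.one_lt_exp_iff.2 hδ
  have hS : sphere (0 : ℂ) 1 ⊆ V := fun w hw => by
    rw [mem_sphere_zero_iff_norm] at hw
    exact hann w (by rw [hw]; exact hrδ.trans_le hr1) (by rw [hw]; exact h1δ)
  have hSr : sphere (0 : ℂ) r ⊆ V := fun w hw => by
    rw [mem_sphere_zero_iff_norm] at hw
    exact hann w (by rw [hw]; exact hrδ) (by rw [hw]; exact hr1.trans_lt h1δ)
  have hA : closedBall (0 : ℂ) 1 \ ball 0 r ⊆ V := fun w hw => by
    simp only [Set.mem_sdiff, mem_closedBall_zero_iff, mem_ball_zero_iff, not_lt] at hw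
    exact hann w (hrδ.trans_le hw.2) (hw.1.trans_lt h1δ)
  have hpV : exp ((δ / 2 : ℝ) : ℂ) ∈ V := hδV _ (by rw [ofReal_re, abs_lt]; constructor <;> linarith)
  -- Around the unit circle the two points agree because `Ω` joins them off the curve; around radius
  -- `r` they agree because the image of an annulus outside that circle joins them. Passing from `r`
  -- to `1` adds `2πi` at the inner point alone.
  have e1 := windingIntegral_eq_of_isPreconnected hV hf zero_le_one hS hΩ hd h1 h2
  have e2 : windingIntegral f r (f (exp ((δ / 2 : ℝ) : ℂ))) =
      windingIntegral f r (f (exp ((-(δ / 2) : ℝ) : ℂ))) := by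
    refine windingIntegral_eq_of_isPreconnected hV hf hr0.le hSr
      (isPreconnected_image_strip (F := fun u => f (exp u)) (α := -(2 * δ / 3)) (β := δ) ?_)
      ?_ ⟨_, ?_, rfl⟩ ⟨_, ?_, rfl⟩
    · refine hf.continuousOn.comp continuous_exp.continuousOn fun u hu => hδV u ?_
      exact abs_lt.2 ⟨by linarith [hu.1], hu.2⟩
    · rw [disjoint_left]
      rintro _ ⟨u, hu, rfl⟩ ⟨w, hw, hwu⟩
      have := hinj (hSr hw) (hδV u (abs_lt.2 ⟨by linarith [hu.1], hu.2⟩)) hwu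
      rw [mem_sphere_zero_iff_norm, this, norm_exp, hr, Real.exp_eq_exp] at hw
      exact hu.1.ne' hw
    · simp only [mem_ofPred_eq, ofReal_re]
      constructor <;> linarith
    · simp only [mem_ofPred_eq, ofReal_re]
      constructor <;> linarith
  have e3 : windingIntegral f 1 (f (exp ((δ / 2 : ℝ) : ℂ))) =
      windingIntegral f r (f (exp ((δ / 2 : ℝ) : ℂ))) := by
    refine windingIntegral_eq_of_notMem hV hf hinj hr0 hr1 hA hpV fun h => ?_
    have := mem_closedBall_zero_iff.1 h.1
    rw [norm_exp, ofReal_re, Real.exp_le_one_iff] at this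
    linarith
  have e4 := windingIntegral_eq_add_of_mem hV hf hinj hr0 hr1 hA
    (a := exp ((-(δ / 2) : ℝ) : ℂ)) (by
      rw [Set.mem_sdiff, mem_ball_zero_iff, mem_closedBall_zero_iff, norm_exp, ofReal_re,
        Real.exp_lt_one_iff, hr, not_le, Real.exp_lt_exp]
      constructor <;> linarith)
  rw [← e1, e3, e2, left_eq_add] at e4
  exact two_pi_I_ne_zero e4

/-- Near its boundary, an analytic domain is the image of a one-sided neighbourhood of the imaginary
axis under a locally univalent map. -/
theorem IsAnalyticDomain.exists_strip_param {Ω : Set ℂ} (h : IsAnalyticDomain Ω) :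
    ∃ (F : ℂ → ℂ) (δ : ℝ), 0 < δ ∧ DifferentiableOn ℂ F {u | |u.re| < δ} ∧
      (∀ u : ℂ, |u.re| < δ → deriv F u ≠ 0) ∧
      (∀ u : ℂ, |u.re| < δ → (F u ∈ Ω ↔ 0 < u.re)) ∧
      (∀ u : ℂ, |u.re| < δ → F u ∈ frontier Ω → u.re = 0) ∧
      ∀ p ∈ frontier Ω, ∃ u : ℂ, u.re = 0 ∧ F u = p := by
  obtain ⟨hΩ, hconn, -, V, f, hV, hS, hfa, hinj, hfr⟩ := h
  have hf : DifferentiableOn ℂ f V := hfa.differentiableOn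
  obtain ⟨δ, hδ, hδV⟩ := exists_strip_mapsTo_exp hV hS
  have hG : ∀ u : ℂ, |u.re| < δ → HasDerivAt (fun u => f (exp u)) (deriv f (exp u) * exp u) u :=
    fun u hu => (hf.differentiableAt (hV.mem_nhds (hδV u hu))).hasDerivAt.comp u (hasDerivAt_exp u)
  have hG0 : ∀ u : ℂ, |u.re| < δ → deriv f (exp u) * exp u ≠ 0 := fun u hu =>
    mul_ne_zero (deriv_ne_zero_of_injOn (hfa _ (hδV u hu)) (hV.mem_nhds (hδV u hu)) hinj)
      (exp_ne_zero u)
  have hGf : ∀ u : ℂ, |u.re| < δ → (f (exp u) ∈ frontier Ω ↔ u.re = 0) := by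
    intro u hu
    rw [hfr]
    constructor
    · rintro ⟨w, hw, hwu⟩
      rw [hinj (hS hw) (hδV u hu) hwu, mem_sphere_zero_iff_norm, norm_exp] at hw
      exact (Real.exp_eq_one_iff _).1 hw
    · intro h
      exact ⟨exp u, by rw [mem_sphere_zero_iff_norm, norm_exp, h, Real.exp_zero], rfl⟩
  have hdΩ : ∀ x ∈ frontier Ω, x ∉ Ω := fun x hx => by
    rw [hΩ.frontier_eq] at hx
    exact hx.2
  have hcont : ∀ s : Set ℂ, (∀ u ∈ s, |u.re| < δ) → ContinuousOn (fun u => f (exp u)) s :=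
    fun s hs u hu => (hG u (hs u hu)).continuousAt.continuousWithinAt
  have hside : ∀ α β : ℝ, -δ ≤ α → β ≤ δ → (0 ≤ α ∨ β ≤ 0) →
      (∀ u : ℂ, α < u.re → u.re < β → f (exp u) ∈ Ω) ∨
      (∀ u : ℂ, α < u.re → u.re < β → f (exp u) ∉ Ω) := by
    intro α β hα hβ hαβ
    have hlt : ∀ u : ℂ, α < u.re → u.re < β → |u.re| < δ := fun u h1 h2 =>
      abs_lt.2 ⟨hα.trans_lt h1, h2.trans_le hβ⟩
    rcases subset_or_disjoint_of_disjoint_frontier hΩ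
      (isPreconnected_image_strip (F := fun u => f (exp u)) (α := α) (β := β)
        (hcont _ fun u hu => hlt u hu.1 hu.2)) (by
        rw [disjoint_left]
        rintro _ ⟨u, hu, rfl⟩ h
        have := (hGf u (hlt u hu.1 hu.2)).1 h
        rcases hαβ with h' | h'
        · exact (h'.trans_lt hu.1).ne' this
        · exact (hu.2.trans_le h').ne this) with h | h
    · exact Or.inl fun u h1 h2 => h ⟨u, ⟨h1, h2⟩, rfl⟩
    · exact Or.inr fun u h1 h2 => disjoint_left.1 h ⟨u, ⟨h1, h2⟩, rfl⟩
  -- The image of the strip is a neighbourhood of the boundary point `f 1`, hence meets `Ω`.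
  have hex : ∃ u : ℂ, |u.re| < δ ∧ f (exp u) ∈ Ω := by
    have h0 : |(0 : ℂ).re| < δ := by simpa using hδ
    have hst : HasStrictDerivAt (fun u => f (exp u)) (deriv f (exp 0) * exp 0) 0 :=
      ((hfa _ (hδV 0 h0)).hasStrictDerivAt).comp 0 (hasStrictDerivAt_exp 0)
    have hmap := hst.map_nhds_eq (hG0 0 h0)
    have hnh : {u : ℂ | |u.re| < δ} ∈ 𝓝 (0 : ℂ) :=
      (isOpen_lt (continuous_abs.comp continuous_re) continuous_const).mem_nhds h0
    have hI := hmap ▸ image_mem_map (m := fun u => f (exp u)) hnh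
    have hc : f (exp 0) ∈ closure Ω := frontier_subset_closure ((hGf 0 h0).2 rfl)
    obtain ⟨_, ⟨u, hu, rfl⟩, huΩ⟩ := mem_closure_iff_nhds.1 hc _ hI
    exact ⟨u, hu, huΩ⟩
  have h0 : ∀ u : ℂ, u.re = 0 → f (exp u) ∉ Ω := fun u hu =>
    hdΩ _ ((hGf u (by rw [hu, abs_zero]; exact hδ)).2 hu)
  have hnb : ¬(f (exp ((δ / 2 : ℝ) : ℂ)) ∈ Ω ∧ f (exp ((-(δ / 2) : ℝ) : ℂ)) ∈ Ω) := fun h =>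
    not_mem_both_sides hV hf hinj hδ hδV hconn.isPreconnected
      (disjoint_left.2 fun x hx hx' => hdΩ x (hfr ▸ hx') hx) h.1 h.2
  -- `σ = ±1` records which half of the strip maps into `Ω`; `hnb` excludes both, `hex` excludes
  -- neither.
  obtain ⟨σ, hσ, hσΩ⟩ : ∃ σ : ℝ, |σ| = 1 ∧
      ∀ u : ℂ, |u.re| < δ → (f (exp u) ∈ Ω ↔ 0 < σ * u.re) := by
    have hp : |(((δ / 2 : ℝ) : ℂ)).re| < δ := by rw [ofReal_re, abs_lt]; constructor <;> linarith
    rcases hside 0 δ (by linarith) le_rfl (Or.inl le_rfl) with hP | hP <;>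
      rcases hside (-δ) 0 le_rfl hδ.le (Or.inr le_rfl) with hN | hN
    · refine (hnb ⟨hP _ ?_ ?_, hN _ ?_ ?_⟩).elim <;> rw [ofReal_re] <;> linarith
    · refine ⟨1, abs_one, fun u hu => ?_⟩
      rw [one_mul]
      rw [abs_lt] at hu
      refine ⟨fun h => ?_, fun h => hP u h hu.2⟩
      by_contra! h'
      rcases h'.lt_or_eq with h' | h'
      · exact hN u hu.1 h' h
      · exact h0 u h' h
    · refine ⟨-1, by simp, fun u hu => ?_⟩
      rw [neg_one_mul, neg_pos]
      rw [abs_lt] at hu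
      refine ⟨fun h => ?_, fun h => hN u hu.1 h⟩
      by_contra! h'
      rcases h'.lt_or_eq with h' | h'
      · exact hP u h' hu.2 h
      · exact h0 u h'.symm h
    · obtain ⟨u, hu, huΩ⟩ := hex
      rw [abs_lt] at hu
      rcases lt_trichotomy u.re 0 with h' | h' | h'
      · exact (hN u hu.1 h' huΩ).elim
      · exact (h0 u h' huΩ).elim
      · exact (hP u h' hu.2 huΩ).elim
  have hσ0 : (σ : ℂ) ≠ 0 := by
    rw [ofReal_ne_zero]
    rintro rfl
    simp at hσ
  have hσσ : σ * σ = 1 := by rw [← abs_mul_abs_self, hσ, one_mul]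
  have hre : ∀ u : ℂ, ((σ : ℂ) * u).re = σ * u.re := fun u => re_ofReal_mul σ u
  have habs : ∀ u : ℂ, |u.re| < δ → |((σ : ℂ) * u).re| < δ := fun u hu => by
    rwa [hre, abs_mul, hσ, one_mul]
  have hF : ∀ u : ℂ, |u.re| < δ → HasDerivAt (fun u => f (exp (σ * u)))
      (deriv f (exp (σ * u)) * exp (σ * u) * (σ * 1)) u := fun u hu =>
    (hG _ (habs u hu)).comp u ((hasDerivAt_id u).const_mul (σ : ℂ))
  refine ⟨fun u => f (exp (σ * u)), δ, hδ,
    fun u hu => (hF u hu).differentiableAt.differentiableWithinAt, fun u hu => ?_, fun u hu => ?_,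
    fun u hu h => ?_, fun p hp => ?_⟩
  · rw [(hF u hu).deriv, mul_one]
    exact mul_ne_zero (hG0 _ (habs u hu)) hσ0
  · rw [hσΩ _ (habs u hu), hre, ← mul_assoc, hσσ, one_mul]
  · have := (hGf _ (habs u hu)).1 h
    rw [hre] at this
    exact (mul_eq_zero.1 this).resolve_left (ofReal_ne_zero.1 hσ0)
  · rw [hfr] at hp
    obtain ⟨w, hw, rfl⟩ := hp
    rw [mem_sphere_zero_iff_norm] at hw
    have hw0 : w ≠ 0 := norm_ne_zero_iff.1 (by rw [hw]; exact one_ne_zero)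
    refine ⟨σ * log w, ?_, ?_⟩
    · rw [hre, log_re, hw, Real.log_one, mul_zero]
    · simp only
      rw [← mul_assoc, ← ofReal_mul, hσσ, ofReal_one, one_mul, exp_log hw0]

end

/-! ### Uniform constants from compactness -/

section glue

variable {n : ℕ}

theorem HasChartBounds.mono {U : Set (EuclideanSpace ℝ (Fin n))}
    {Φ : EuclideanSpace ℝ (Fin n) → EuclideanSpace ℝ (Fin n)} {C C₁ C₃ C' C₁' C₃' : ℝ}
    {C₂ C₂' : ℝ≥0} (h : HasChartBounds U Φ C C₁ C₂ C₃) (hC0 : 0 < C) (hC30 : 0 < C₃)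
    (hC : C ≤ C') (hC₁ : C₁ ≤ C₁') (hC₂ : C₂ ≤ C₂') (hC₃ : C₃ ≤ C₃') :
    HasChartBounds U Φ C' C₁' C₂' C₃' where
  bilipschitz x hx y hy := by
    obtain ⟨h1, h2⟩ := h.bilipschitz x hx y hy
    exact ⟨(div_le_div_of_nonneg_left (norm_nonneg _) hC0 hC).trans h1,
      h2.trans (mul_le_mul_of_nonneg_right hC (norm_nonneg _))⟩
  partialDeriv_le i j x hx := (h.partialDeriv_le i j x hx).trans hC₁
  laplacian_le i x hx := (h.laplacian_le i x hx).trans hC₁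
  partialDeriv_lipschitz i j := (h.partialDeriv_lipschitz i j).weaken hC₂
  laplacian_lipschitz i := (h.laplacian_lipschitz i).weaken hC₂
  jacobian_bounds x hx v := by
    obtain ⟨h1, h2⟩ := h.jacobian_bounds x hx v
    have hv : 0 ≤ v ⬝ᵥ v := Finset.sum_nonneg fun i _ => mul_self_nonneg (v i)
    exact ⟨(mul_le_mul_of_nonneg_right (inv_anti₀ hC30 hC₃) hv).trans h1,
      h2.trans (mul_le_mul_of_nonneg_right hC₃ hv)⟩

variable [NeZero n]

/-- A boundary chart that respects the normals and satisfies the quantitative bounds. -/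
def HasGoodChart (Ω : Set (EuclideanSpace ℝ (Fin n))) (x : EuclideanSpace ℝ (Fin n)) : Prop :=
  ∃ B : BoundaryChart Ω x, MapsNormalToFirstAxis Ω B.map.source B.map ∧
    ∃ (C C₁ : ℝ) (C₂ : ℝ≥0) (C₃ : ℝ), 0 < C ∧ 0 ≤ C₁ ∧ 0 < C₃ ∧
      HasChartBounds B.map.source B.map C C₁ C₂ C₃

/-- For a domain with compact boundary, the uniformity in the definition of a SULD is automatic. -/
theorem isSULD_of_isCompact_frontier {Ω : Set (EuclideanSpace ℝ (Fin n))} (ho : IsOpen Ω)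
    (hc : IsConnected Ω) (hK : IsCompact (frontier Ω))
    (h : ∀ x ∈ frontier Ω, HasGoodChart Ω x) : IsSULD Ω := by
  choose B hB C C₁ C₂ C₃ hC hC₁ hC₃ hbd using fun x : frontier Ω => h x x.2
  refine ⟨⟨ho, hc, fun x hx => ⟨B ⟨x, hx⟩⟩⟩, B, ?_⟩
  obtain ⟨t, ht⟩ := hK.elim_nhds_subcover' (fun x hx => (B ⟨x, hx⟩).map.source) fun x hx => by
    rw [(B ⟨x, hx⟩).source_eq]
    exact ball_mem_nhds x (B ⟨x, hx⟩).radius_pos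
  -- Sums over the finite subcover dominate every individual constant; the added `1` keeps `C` and
  -- `C₃` positive if the subcover is empty.
  refine ⟨Ω, ↑t, ho, subset_rfl, t.countable_toSet, ?_, fun x _ => hB x, 1 + ∑ x ∈ t, C x,
    ∑ x ∈ t, C₁ x, ∑ x ∈ t, C₂ x, 1 + ∑ x ∈ t, C₃ x, ?_, ?_, fun x hx => ?_⟩
  · rw [closure_eq_self_union_frontier]
    exact union_subset_union_right Ω ht
  · exact add_pos_of_pos_of_nonneg one_pos (Finset.sum_nonneg fun x _ => (hC x).le)
  · exact add_pos_of_pos_of_nonneg one_pos (Finset.sum_nonneg fun x _ => (hC₃ x).le)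
  · refine (hbd x).mono (hC x) (hC₃ x) ?_ ?_ ?_ ?_
    · exact (Finset.single_le_sum (fun y _ => (hC y).le) hx).trans (le_add_of_nonneg_left zero_le_one)
    · exact Finset.single_le_sum (fun y _ => hC₁ y) hx
    · exact Finset.single_le_sum (f := C₂) (fun y _ => zero_le) hx
    · exact (Finset.single_le_sum (fun y _ => (hC₃ y).le) hx).trans
        (le_add_of_nonneg_left zero_le_one)

end glue

/-! ### Local bounds for diffeomorphisms -/

section localBounds

variable {n : ℕ}

theorem exists_lipschitzOnWith_and_abs_le {E : Type*} [NormedAddCommGroup E] [NormedSpace ℝ E]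
    {g : E → ℝ} {x : E} (hg : ContDiffAt ℝ 1 g x) :
    ∃ K : ℝ≥0, ∃ t ∈ 𝓝 x, LipschitzOnWith K g t ∧ ∀ y ∈ t, |g y| ≤ K := by
  obtain ⟨K, t, ht, hK⟩ := hg.exists_lipschitzOnWith
  have h1 : ∀ᶠ y in 𝓝 x, |g y| < |g x| + 1 :=
    (continuous_abs.continuousAt.comp hg.continuousAt).eventually_lt_const (lt_add_one _)
  refine ⟨K + (|g x| + 1).toNNReal, t ∩ {y | |g y| < |g x| + 1}, inter_mem ht h1,
    (hK.mono inter_subset_left).weaken le_self_add, fun y hy => hy.2.le.trans ?_⟩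
  rw [NNReal.coe_add, Real.coe_toNNReal _ (by positivity)]
  exact le_add_of_nonneg_left K.2

theorem contDiffAt_component {Φ : EuclideanSpace ℝ (Fin n) → EuclideanSpace ℝ (Fin n)}
    {x : EuclideanSpace ℝ (Fin n)} {m : WithTop ℕ∞} (h : ContDiffAt ℝ m Φ x) (i : Fin n) :
    ContDiffAt ℝ m (component Φ i) x :=
  (EuclideanSpace.proj i : EuclideanSpace ℝ (Fin n) →L[ℝ] ℝ).contDiff.contDiffAt.comp x h

theorem contDiffAt_partialDeriv {Φ : EuclideanSpace ℝ (Fin n) → EuclideanSpace ℝ (Fin n)}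
    {x : EuclideanSpace ℝ (Fin n)} (h : ContDiffAt ℝ ∞ Φ x) (i j : Fin n) :
    ContDiffAt ℝ 1 (partialDeriv Φ i j) x :=
  ((contDiffAt_component h i).fderiv_right (m := 1) (WithTop.coe_le_coe.2 le_top : ((1 + 1 : ℕ∞) : WithTop ℕ∞) ≤ ∞)).clm_apply
    contDiffAt_const

theorem contDiffAt_laplacian {g : EuclideanSpace ℝ (Fin n) → ℝ}
    {x : EuclideanSpace ℝ (Fin n)} (h : ContDiffAt ℝ ∞ g x) :
    ContDiffAt ℝ 1 (Laplacian.laplacian g) x := by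
  rw [InnerProductSpace.laplacian_eq_iteratedFDeriv_stdOrthonormalBasis]
  refine ContDiffAt.sum fun i _ => ?_
  have h1 : ContDiffAt ℝ 1 (iteratedFDeriv ℝ 2 g) x :=
    h.iteratedFDeriv_right (WithTop.coe_le_coe.2 le_top : ((1 + 2 : ℕ∞) : WithTop ℕ∞) ≤ ∞)
  exact (ContinuousMultilinearMap.apply ℝ (fun _ : Fin 2 => EuclideanSpace ℝ (Fin n)) ℝ
    _).contDiff.contDiffAt.comp x h1

theorem gradient_component_apply (Φ : EuclideanSpace ℝ (Fin n) → EuclideanSpace ℝ (Fin n))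
    (i j : Fin n) (x : EuclideanSpace ℝ (Fin n)) :
    gradient (component Φ i) x j = partialDeriv Φ i j x := by
  have h : inner ℝ (gradient (component Φ i) x) (EuclideanSpace.single j (1 : ℝ)) =
      partialDeriv Φ i j x := InnerProductSpace.toDual_symm_apply
  rw [← h, EuclideanSpace.inner_single_right]
  simp

/-- A diffeomorphism is locally bi-Lipschitz, with locally bounded and Lipschitz derivatives. -/
theorem exists_local_bounds (e : OpenPartialHomeomorph (EuclideanSpace ℝ (Fin n))
      (EuclideanSpace ℝ (Fin n))) {x : EuclideanSpace ℝ (Fin n)} (hx : x ∈ e.source)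
    (he : ContDiffAt ℝ ∞ e x) (he' : ContDiffAt ℝ ∞ e.symm (e x)) :
    ∃ (C : ℝ) (K : ℝ≥0), 0 < C ∧ ∃ t ∈ 𝓝 x,
      (∀ y ∈ t, ∀ z ∈ t, ‖y - z‖ / C ≤ ‖e y - e z‖ ∧ ‖e y - e z‖ ≤ C * ‖y - z‖) ∧
      (∀ i j, LipschitzOnWith K (partialDeriv e i j) t ∧ ∀ y ∈ t, |partialDeriv e i j y| ≤ K) ∧
      ∀ i, LipschitzOnWith K (Laplacian.laplacian (component e i)) t ∧
        ∀ y ∈ t, |Laplacian.laplacian (component e i) y| ≤ K := by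
  choose K t ht hK hb using fun i j =>
    exists_lipschitzOnWith_and_abs_le (contDiffAt_partialDeriv he i j)
  choose L s hs hL hbL using fun i =>
    exists_lipschitzOnWith_and_abs_le (contDiffAt_laplacian (contDiffAt_component he i))
  have h1 : (1 : WithTop ℕ∞) ≤ ∞ := by exact_mod_cast le_top
  obtain ⟨M, u, hu, hM⟩ := (he.of_le h1).exists_lipschitzOnWith
  -- A Lipschitz bound for the inverse is the lower half of the bi-Lipschitz estimate.
  obtain ⟨N, v, hv, hN⟩ := (he'.of_le h1).exists_lipschitzOnWith
  have hKle : ∀ i j, K i j ≤ (∑ i, ∑ j, K i j) + ∑ i, L i := fun i j =>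
    ((Finset.single_le_sum (f := fun j => K i j) (fun _ _ => zero_le) (Finset.mem_univ j)).trans
      (Finset.single_le_sum (f := fun i => ∑ j, K i j) (fun _ _ => zero_le)
        (Finset.mem_univ i))).trans le_self_add
  have hLle : ∀ i, L i ≤ (∑ i, ∑ j, K i j) + ∑ i, L i := fun i =>
    (Finset.single_le_sum (f := L) (fun _ _ => zero_le) (Finset.mem_univ i)).trans le_add_self
  refine ⟨1 + M + N, (∑ i, ∑ j, K i j) + ∑ i, L i, by positivity,
    (((⋂ i, ⋂ j, t i j) ∩ ⋂ i, s i) ∩ (u ∩ e ⁻¹' v)) ∩ e.source,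
    inter_mem (inter_mem (inter_mem (iInter_mem.2 fun i => iInter_mem.2 fun j => ht i j)
      (iInter_mem.2 hs)) (inter_mem hu ((e.continuousAt hx).preimage_mem_nhds hv)))
      (e.open_source.mem_nhds hx), ?_, fun i j => ?_, fun i => ?_⟩
  · rintro y ⟨⟨-, hyu, hyv⟩, hye⟩ z ⟨⟨-, hzu, hzv⟩, hze⟩
    have h1 := hM.dist_le_mul y hyu z hzu
    have h2 := hN.dist_le_mul _ hyv _ hzv
    rw [e.left_inv hye, e.left_inv hze] at h2
    rw [dist_eq_norm, dist_eq_norm] at h1 h2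
    refine ⟨(div_le_iff₀ (by positivity)).2 (h2.trans ?_), h1.trans ?_⟩
    · rw [mul_comm]
      exact mul_le_mul_of_nonneg_left (by linarith [NNReal.coe_nonneg M, NNReal.coe_nonneg N])
        (norm_nonneg _)
    · exact mul_le_mul_of_nonneg_right (by linarith [NNReal.coe_nonneg M, NNReal.coe_nonneg N])
        (norm_nonneg _)
  · have hsub : (((⋂ i, ⋂ j, t i j) ∩ ⋂ i, s i) ∩ (u ∩ e ⁻¹' v)) ∩ e.source ⊆ t i j :=
      fun y hy => mem_iInter.1 (mem_iInter.1 hy.1.1.1 i) j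
    exact ⟨((hK i j).mono hsub).weaken (hKle i j), fun y hy =>
      (hb i j y (hsub hy)).trans (NNReal.coe_le_coe.2 (hKle i j))⟩
  · have hsub : (((⋂ i, ⋂ j, t i j) ∩ ⋂ i, s i) ∩ (u ∩ e ⁻¹' v)) ∩ e.source ⊆ s i :=
      fun y hy => mem_iInter.1 hy.1.1.2 i
    exact ⟨((hL i).mono hsub).weaken (hLle i), fun y hy =>
      (hbL i y (hsub hy)).trans (NNReal.coe_le_coe.2 (hLle i))⟩

end localBounds

/-! ### Inward normal from a defining function -/

section normal

variable {n : ℕ} [NeZero n] {Ω W : Set (EuclideanSpace ℝ (Fin n))}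
  {Φ : EuclideanSpace ℝ (Fin n) → EuclideanSpace ℝ (Fin n)} {x : EuclideanSpace ℝ (Fin n)}

/-- The normalized gradient of a defining function is the inward unit normal. -/
theorem isInwardUnitNormal_of_defining (hW : W ∈ 𝓝 x) (hx : x ∈ frontier Ω)
    (hd : DifferentiableAt ℝ (component Φ 0) x) (hpos : ∀ y ∈ W, 0 < Φ y 0 → y ∈ Ω)
    (hfr : ∀ y ∈ W, y ∈ frontier Ω → Φ y 0 = 0) (hg : gradient (component Φ 0) x ≠ 0) :
    IsInwardUnitNormal Ω x
      (‖gradient (component Φ 0) x‖⁻¹ • gradient (component Φ 0) x) := by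
  set g := gradient (component Φ 0) x with hgdef
  have hgn : 0 < ‖g‖ := norm_pos_iff.2 hg
  have hin : ∀ v, inner ℝ g v = fderiv ℝ (component Φ 0) x v := fun v =>
    InnerProductSpace.toDual_symm_apply
  refine ⟨?_, ?_, ?_⟩
  · rw [norm_smul, norm_inv, norm_norm, inv_mul_cancel₀ hgn.ne']
  · rintro v ⟨c, hc0, hc, hcM⟩
    rw [real_inner_smul_left, hin]
    have h1 : HasDerivAt (fun t => component Φ 0 (c t)) (fderiv ℝ (component Φ 0) x v) 0 := by
      have h2 : HasFDerivAt (component Φ 0) (fderiv ℝ (component Φ 0) x) (c 0) := by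
        rw [hc0]
        exact hd.hasFDerivAt
      exact h2.comp_hasDerivAt 0 hc
    -- A curve in `∂Ω` stays in the zero set of the first component, so the derivative along it
    -- vanishes.
    have h3 : (fun t => component Φ 0 (c t)) =ᶠ[𝓝 0] fun _ => 0 := by
      filter_upwards [hcM, hc.continuousAt.preimage_mem_nhds (by rwa [hc0])] with t ht htW
      exact hfr _ htW ht
    rw [h1.unique ((hasDerivAt_const (0 : ℝ) (0 : ℝ)).congr_of_eventuallyEq h3), mul_zero]
  · set γ := ‖g‖⁻¹ • g
    have hγ : fderiv ℝ (component Φ 0) x γ = ‖g‖ := by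
      rw [← hin, real_inner_smul_right, real_inner_self_eq_norm_sq]
      field_simp
    have hl : HasDerivAt (fun t : ℝ => x + t • γ) γ 0 := by
      simpa using ((hasDerivAt_id (0 : ℝ)).smul_const γ).const_add x
    have h1 : HasDerivAt (fun t : ℝ => component Φ 0 (x + t • γ)) ‖g‖ 0 := by
      have h2 : HasFDerivAt (component Φ 0) (fderiv ℝ (component Φ 0) x) (x + (0 : ℝ) • γ) := by
        rw [zero_smul, add_zero]
        exact hd.hasFDerivAt
      rw [← hγ]
      exact h2.comp_hasDerivAt 0 hl
    have h3 := (hasDerivAt_iff_tendsto_slope.1 h1).eventually_const_lt hgn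
    have h4 : ∀ᶠ t : ℝ in 𝓝 0, x + t • γ ∈ W :=
      hl.continuousAt.preimage_mem_nhds (by simpa using hW)
    -- The slope along `γ` tends to `‖g‖ > 0`, so the first component becomes positive just after
    -- leaving `x`.
    filter_upwards [nhdsWithin_mono _ (fun t ht => (mem_Ioi.1 ht).ne') h3,
      nhdsWithin_le_nhds h4, self_mem_nhdsWithin] with t ht htW ht0
    refine hpos _ htW ?_
    have h5 : component Φ 0 (x + (0 : ℝ) • γ) = 0 := by
      rw [zero_smul, add_zero]
      exact hfr x (mem_of_mem_nhds hW) hx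
    rw [slope_def_field, h5, sub_zero, sub_zero] at ht
    exact (div_pos_iff_of_pos_right ht0).1 ht

end normal

/-! ### Conformal charts -/

section conformal

variable {Ω : Set (EuclideanSpace ℝ (Fin 2))}

/-- Under the Cauchy–Riemann equations the rows of `J` are `(a, b)` and `(-b, a)`, so `J Jᵀ = (a² +
b²) I`. -/
theorem dotProduct_jacobian_mul_transpose_mulVec
    {Φ : EuclideanSpace ℝ (Fin 2) → EuclideanSpace ℝ (Fin 2)} {x : EuclideanSpace ℝ (Fin 2)}
    (h1 : partialDeriv Φ 1 1 x = partialDeriv Φ 0 0 x)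
    (h2 : partialDeriv Φ 1 0 x = -partialDeriv Φ 0 1 x) (v : Fin 2 → ℝ) :
    v ⬝ᵥ (jacobian Φ x * (jacobian Φ x).transpose).mulVec v =
      (partialDeriv Φ 0 0 x ^ 2 + partialDeriv Φ 0 1 x ^ 2) * (v ⬝ᵥ v) := by
  simp only [jacobian, dotProduct, Matrix.mulVec, Matrix.mul_apply, Matrix.transpose_apply,
    Matrix.of_apply, Fin.sum_univ_two, h1, h2]
  ring

/-- A conformal local coordinate in which `Ω` is given by positivity of the first coordinate
restricts to a good boundary chart. -/
theorem hasGoodChart_of_conformal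
    (e : OpenPartialHomeomorph (EuclideanSpace ℝ (Fin 2)) (EuclideanSpace ℝ (Fin 2)))
    (he : ContDiffOn ℝ ∞ e e.source) (he' : ContDiffOn ℝ ∞ e.symm e.target)
    (hpos : ∀ y ∈ e.source, y ∈ Ω ↔ 0 < e y 0)
    (hfr : ∀ y ∈ e.source, y ∈ frontier Ω → e y 0 = 0)
    (h1 : ∀ y ∈ e.source, partialDeriv e 1 1 y = partialDeriv e 0 0 y)
    (h2 : ∀ y ∈ e.source, partialDeriv e 1 0 y = -partialDeriv e 0 1 y)
    (h0 : ∀ y ∈ e.source, 0 < partialDeriv e 0 0 y ^ 2 + partialDeriv e 0 1 y ^ 2)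
    {x : EuclideanSpace ℝ (Fin 2)} (hx : x ∈ e.source) : HasGoodChart Ω x := by
  have hat : ∀ y ∈ e.source, ContDiffAt ℝ ∞ e y := fun y hy =>
    he.contDiffAt (e.open_source.mem_nhds hy)
  obtain ⟨C, K, hC, t, ht, hbi, hpd, hlap⟩ := exists_local_bounds e hx (hat x hx)
    (he'.contDiffAt (e.open_target.mem_nhds (e.map_source hx)))
  set q := fun y => partialDeriv e 0 0 y ^ 2 + partialDeriv e 0 1 y ^ 2 with hq
  have hqc : ContinuousAt q x :=
    ((contDiffAt_partialDeriv (hat x hx) 0 0).continuousAt.pow 2).add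
      ((contDiffAt_partialDeriv (hat x hx) 0 1).continuousAt.pow 2)
  have hqx : 0 < q x := h0 x hx
  have hu := hqc.eventually_lt_const (lt_add_one (q x))
  have hl := hqc.eventually_const_lt (half_lt_self hqx)
  obtain ⟨r, hr, hball⟩ := Metric.mem_nhds_iff.1
    (inter_mem (inter_mem ht (e.open_source.mem_nhds hx)) (inter_mem hu hl))
  have hbe : ball x r ⊆ e.source := fun y hy => (hball hy).1.2
  have hsrc : (e.restrOpen (ball x r) isOpen_ball).source = ball x r := by
    rw [e.restrOpen_source, inter_eq_right]
    exact hbe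
  let B : BoundaryChart Ω x :=
    { radius := r
      radius_pos := hr
      map := e.restrOpen (ball x r) isOpen_ball
      source_eq := hsrc
      smooth := he.mono (by rw [hsrc]; exact hbe)
      smooth_symm := he'.mono fun y hy => hy.1
      interior_mem := fun y hy => (hpos y (hbe (hsrc ▸ hy.1))).1 hy.2
      boundary_mem := fun y hy => hfr y (hbe (hsrc ▸ hy.1)) hy.2 }
  have hBs : B.map.source = ball x r := hsrc
  have hBe : (B.map : EuclideanSpace ℝ (Fin 2) → EuclideanSpace ℝ (Fin 2)) = e := rfl
  -- On the ball `q x / 2 < q < q x + 1`; this `C₃` exceeds the upper bound, and its inverse is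
  -- below the lower one.
  refine ⟨B, ?_, C, K, K, q x + 1 + 2 / q x, hC, K.2, by positivity, ?_⟩
  · rw [hBs, hBe]
    rintro y ⟨hy, hyf⟩
    have hye := hbe hy
    have hg : gradient (component e 0) y ≠ 0 := fun h => by
      have h3 := h0 y hye
      rw [← gradient_component_apply, ← gradient_component_apply, h] at h3
      simp at h3
    refine ⟨_, isInwardUnitNormal_of_defining (e.open_source.mem_nhds hye) hyf
      ((contDiffAt_component (hat y hye) 0).differentiableAt (by simp))
      (fun z hz => (hpos z hz).2) hfr hg, fun i => ?_⟩
    rw [real_inner_smul_right]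
    fin_cases i
    · have := norm_pos_iff.2 hg
      simp only [Fin.zero_eta, if_true, real_inner_self_eq_norm_sq]
      field_simp
    -- The second gradient is the first turned by a right angle.
    · simp only [Fin.mk_one, one_ne_zero, if_false, PiLp.inner_apply, Fin.sum_univ_two,
        gradient_component_apply, h1 y hye, h2 y hye, RCLike.inner_apply, conj_trivial]
      ring
  · rw [hBs, hBe]
    have hbt : ball x r ⊆ t := fun y hy => (hball hy).1.1
    refine ⟨fun y hy z hz => hbi y (hbt hy) z (hbt hz), fun i j y hy => (hpd i j).2 y (hbt hy),
      fun i y hy => (hlap i).2 y (hbt hy), fun i j => (hpd i j).1.mono hbt,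
      fun i => (hlap i).1.mono hbt, fun y hy v => ?_⟩
    rw [dotProduct_jacobian_mul_transpose_mulVec (h1 y (hbe hy)) (h2 y (hbe hy))]
    have hv : 0 ≤ v ⬝ᵥ v := Finset.sum_nonneg fun i _ => mul_self_nonneg (v i)
    have hqu : q y < q x + 1 := (hball hy).2.1
    have hql : q x / 2 < q y := (hball hy).2.2
    have h2q : 0 < 2 / q x := by positivity
    refine ⟨mul_le_mul_of_nonneg_right (le_trans ?_ hql.le) hv,
      mul_le_mul_of_nonneg_right (hqu.le.trans (by linarith)) hv⟩
    exact (inv_anti₀ h2q (by linarith)).trans_eq (inv_div 2 (q x))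

end conformal

/-! ### Holomorphic charts read in the plane -/

theorem toPlane_apply_zero (z : ℂ) : toPlane z 0 = z.re := by
  simp [toPlane, Complex.orthonormalBasisOneI_repr_apply]

theorem toPlane_apply_one (z : ℂ) : toPlane z 1 = z.im := by
  simp [toPlane, Complex.orthonormalBasisOneI_repr_apply]

theorem toPlane_symm_single (j : Fin 2) :
    toPlane.symm (EuclideanSpace.single j 1) = ![1, Complex.I] j := by
  rw [toPlane, OrthonormalBasis.repr_symm_single, Complex.coe_orthonormalBasisOneI]

/-- The partial derivatives of a holomorphic map read in the plane. -/
theorem partialDeriv_toPlane_conj {φ : ℂ → ℂ} {a : ℂ} {y : EuclideanSpace ℝ (Fin 2)}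
    (h : HasDerivAt φ a (toPlane.symm y)) (i j : Fin 2) :
    partialDeriv (fun x => toPlane (φ (toPlane.symm x))) i j y =
      toPlane (a * ![1, Complex.I] j) i := by
  have h1 : HasFDerivAt (fun x => φ (toPlane.symm x)) _ y :=
    (h.hasFDerivAt.restrictScalars ℝ).comp y
      toPlane.symm.toContinuousLinearEquiv.hasFDerivAt
  have h2 := (toPlane.toContinuousLinearEquiv.hasFDerivAt.comp y h1)
  have h3 := (EuclideanSpace.proj i : EuclideanSpace ℝ (Fin 2) →L[ℝ] ℝ).hasFDerivAt.comp y h2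
  have h4 : fderiv ℝ (component (fun x => toPlane (φ (toPlane.symm x))) i) y = _ := h3.fderiv
  rw [partialDeriv, h4, ← toPlane_symm_single]
  simp [mul_comm]

/-- Near each point of the strip, a locally univalent map has a holomorphic inverse. -/
theorem exists_holomorphic_chart {F : ℂ → ℂ} {U : Set ℂ} (hU : IsOpen U)
    (hF : DifferentiableOn ℂ F U) (hF' : ∀ u ∈ U, deriv F u ≠ 0) {u : ℂ} (hu : u ∈ U) :
    ∃ φ : OpenPartialHomeomorph ℂ ℂ, F u ∈ φ.source ∧ φ.target ⊆ U ∧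
      (∀ z ∈ φ.source, F (φ z) = z) ∧ (∀ z ∈ φ.source, ContDiffAt ℂ ∞ φ z) ∧
      (∀ z ∈ φ.source, HasDerivAt φ (deriv F (φ z))⁻¹ z) ∧ ContDiffOn ℂ ∞ φ.symm φ.target := by
  have hsm : ∀ v ∈ U, ContDiffAt ℂ ∞ F v := fun v hv =>
    (hF.analyticAt (hU.mem_nhds hv)).contDiffAt
  have hder : ∀ v ∈ U, HasDerivAt F (deriv F v) v := fun v hv =>
    (hF.differentiableAt (hU.mem_nhds hv)).hasDerivAt
  -- Restricting to `U` keeps the values of the inverse in the region where `F` is controlled.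
  set e := ((hsm u hu).toOpenPartialHomeomorph F
    ((hder u hu).hasFDerivAt_equiv (hF' u hu)) (by simp)).restrOpen U hU
  have heU : e.source ⊆ U := fun v hv => hv.2
  have hue : u ∈ e.source := ⟨ContDiffAt.mem_toOpenPartialHomeomorph_source _ _ _, hu⟩
  have hinv : ∀ z ∈ e.target, e.symm z ∈ U := fun z hz => heU (e.map_target hz)
  refine ⟨e.symm, e.map_source hue, heU, fun z hz => e.right_inv hz, fun z hz => ?_, fun z hz => ?_,
    fun v hv => (hsm v (heU hv)).contDiffWithinAt⟩
  · exact e.contDiffAt_symm_deriv (hF' _ (hinv z hz)) hz (hder _ (hinv z hz)) (hsm _ (hinv z hz))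
  · exact e.hasDerivAt_symm hz (hF' _ (hinv z hz)) (hder _ (hinv z hz))

theorem IsAnalyticDomain.isSULD {Ω : Set ℂ} (h : IsAnalyticDomain Ω) :
    IsSULD (toPlane '' Ω) := by
  have hfrontier : frontier (toPlane '' Ω) = toPlane '' frontier Ω :=
    (toPlane.toHomeomorph.image_frontier Ω).symm
  refine isSULD_of_isCompact_frontier (toPlane.toHomeomorph.isOpenMap Ω h.isOpen)
    (h.isConnected.image _ toPlane.continuous.continuousOn) ?_ ?_
  · obtain ⟨V, f, -, hS, hfa, -, hfr⟩ := h.frontier_eq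
    rw [hfrontier, hfr]
    exact ((isCompact_sphere (0 : ℂ) 1).image_of_continuousOn
      (hfa.continuousOn.mono hS)).image toPlane.continuous
  obtain ⟨F, δ, hδ, hF, hF', hpos, hfr, hsurj⟩ := h.exists_strip_param
  rw [hfrontier]
  rintro _ ⟨p, hp, rfl⟩
  obtain ⟨u, hu, rfl⟩ := hsurj p hp
  obtain ⟨φ, hφu, hφU, hinv, hφ, hφ', hφs⟩ := exists_holomorphic_chart
    (isOpen_lt (continuous_abs.comp Complex.continuous_re) continuous_const) hF hF'
    (u := u) (show |u.re| < δ by rwa [hu, abs_zero])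
  have hmem : ∀ z ∈ φ.source, |(φ z).re| < δ := fun z hz => hφU (φ.map_source hz)
  -- The chart is the local inverse `φ` of `F`, conjugated by the identification of `ℂ` with the
  -- plane; its first coordinate is `Re φ`.
  set e := (toPlane.symm.toHomeomorph.transOpenPartialHomeomorph φ).transHomeomorph
    toPlane.toHomeomorph
  have hec : (e : EuclideanSpace ℝ (Fin 2) → EuclideanSpace ℝ (Fin 2)) =
    fun x => toPlane (φ (toPlane.symm x)) := rfl
  have hes : ∀ y, y ∈ e.source ↔ toPlane.symm y ∈ φ.source := fun y => Iff.rfl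
  have hpd : ∀ y ∈ e.source, ∀ i j, partialDeriv e i j y =
      toPlane ((deriv F (φ (toPlane.symm y)))⁻¹ * ![1, Complex.I] j) i := fun y hy i j =>
    partialDeriv_toPlane_conj (hφ' _ ((hes y).1 hy)) i j
  refine hasGoodChart_of_conformal e ?_ ?_ ?_ ?_ ?_ ?_ ?_ (x := toPlane (F u)) ?_
  · intro y hy
    exact (toPlane.toContinuousLinearEquiv.contDiff.contDiffAt.comp y
      (((hφ _ hy).restrict_scalars ℝ).comp y
        toPlane.symm.toContinuousLinearEquiv.contDiff.contDiffAt)).contDiffWithinAt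
  · exact toPlane.toContinuousLinearEquiv.contDiff.comp_contDiffOn
      ((hφs.restrict_scalars ℝ).comp
        toPlane.symm.toContinuousLinearEquiv.contDiff.contDiffOn fun y hy => hy)
  · intro y hy
    rw [hec]
    simp only [toPlane_apply_zero]
    rw [← hpos _ (hmem _ ((hes y).1 hy)), hinv _ ((hes y).1 hy)]
    constructor
    · rintro ⟨z, hz, rfl⟩
      rwa [LinearIsometryEquiv.symm_apply_apply]
    · exact fun hy => ⟨_, hy, LinearIsometryEquiv.apply_symm_apply _ _⟩
  · intro y hy hyf
    rw [hfrontier] at hyf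
    obtain ⟨z, hz, rfl⟩ := hyf
    rw [hec]
    simp only [toPlane_apply_zero]
    refine hfr _ (hmem _ ((hes _).1 hy)) ?_
    rwa [hinv _ ((hes _).1 hy), LinearIsometryEquiv.symm_apply_apply]
  · intro y hy
    simp [hpd y hy, toPlane_apply_zero, toPlane_apply_one]
  · intro y hy
    simp [hpd y hy, toPlane_apply_zero, toPlane_apply_one]
  · intro y hy
    -- The sum of squares in the goal is `|1 / F'|²`.
    have h0 := Complex.normSq_pos.2 (inv_ne_zero (hF' _ (hmem _ ((hes y).1 hy))))
    rw [Complex.normSq_apply] at h0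
    rw [hpd y hy, hpd y hy]
    simp only [toPlane_apply_zero, Matrix.cons_val_zero, Matrix.cons_val_one, mul_one,
      Complex.mul_I_re]
    linarith
  · rw [hes, LinearIsometryEquiv.symm_apply_apply]
    exact hφu

theorem isAnalyticDomain_ball : IsAnalyticDomain (ball (0 : ℂ) 1) where
  isOpen := isOpen_ball
  isConnected := (convex_ball 0 1).isConnected ⟨0, by simp⟩
  ne_univ h := by
    have : (1 : ℂ) ∈ ball (0 : ℂ) 1 := h ▸ mem_univ _
    simp at this
  frontier_eq := ⟨univ, id, isOpen_univ, subset_univ _, analyticOnNhd_id, injOn_id _, by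
    rw [frontier_ball _ one_ne_zero, image_id]⟩

end SULD

theorem mainTheorem5 :
    SULD.IsSULD (SULD.toPlane '' Metric.ball (0 : ℂ) 1) ∧
      ∀ Ω : Set ℂ, SULD.IsAnalyticDomain Ω → SULD.IsSULD (SULD.toPlane '' Ω) :=
  ⟨SULD.isAnalyticDomain_ball.isSULD, fun _ h => h.isSULD⟩
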